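/- For $i\in\{1,2\}$ let $n_i,m_i\ge 0$ be integers. Consider the following two-player game (a \emph{trivial NASP}, i.e. a Nash game between two Stackelberg leaders, each with one follower). Leader $i$ chooses $z^i=(x^i,y^i)\in\mathbb R^{n_i}\times\mathbb R^{m_i}$ from the feasible set $$\mathscr F_i=\bigl\{(x,y)\in\mathbb R^{n_i}\times\mathbb R^{m_i} : (x,y)\in K_i,\ y\in\mathrm{SOL}_i(x)\bigr\},$$ where $K_i\subseteq\mathbb R^{n_i}\times\mathbb R^{m_i}$ is a polyhedron (the solution set of finitely many linear inequalities) and $\mathrm{SOL}_i(x)$ is the set of optimal solutions of the follower's parametric linear program $$\min_{y\in\mathbb R^{m_i}}\bigl\{(q^i+D^ix)^\top y : y\in H_i,\ A^ix+B^iy\le b^i\bigr\}$$ with a polyhedron $H_i\subseteq\mathbb R^{m_i}$ and real vectors $q^i,b^i$ and matrices $D^i,A^i,B^i$ of appropriate sizes. Leader $i$ minimizes $f^i(z^i;z^{-i})=(c^i+C^iz^{-i})^\top z^i$ over $\mathscr F_i$, where $z^{-i}$ is the choice of the other leader and $c^i$, $C^i$ are a real vector and a real matrix. A \emph{mixed-strategy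 Nash equilibrium} (MNE) is a pair $(\nu^1,\nu^2)$ of probability distributions, $\nu^i$ with finite support contained in $\mathscr F_i$, such that for $i=1,2$ and every $\tilde z\in\mathscr F_i$ $$\mathbb E\,f^i(z^i;z^{-i})\le\mathbb E\,f^i(\tilde z;z^{-i}),\qquad z^1\sim\nu^1,\ z^2\sim\nu^2\ \text{independent}.$$ If $\mathscr F_1$ and $\mathscr F_2$ are both non-empty and bounded, then the game has an MNE. -/

import Mathlib

open MeasureTheory Matrix

/-- A polyhedron: the solution set of finitely many (weak) linear inequalities. -/
def IsPolyhedron {κ : Type*} [Fintype κ] (S : Set (κ → ℝ)) : Prop :=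
  ∃ (m : ℕ) (A : Matrix (Fin m) κ ℝ) (b : Fin m → ℝ), S = {x | A *ᵥ x ≤ b}

/-- A Nash game with players `ι`: player `i` chooses `xⁱ ∈ ℝ^(κ i)`, and minimizes
`cost i (x¹, …, xⁿ)` over `xⁱ ∈ feasible i`, simultaneously with the other players. -/
structure NashGame {ι : Type*} (κ : ι → Type*) where
  cost : (i : ι) → ((j : ι) → κ j → ℝ) → ℝ
  feasible : (i : ι) → Set (κ i → ℝ)

namespace NashGame

variable {ι : Type*} [Fintype ι] [DecidableEq ι] {κ : ι → Type*} [∀ i, Fintype (κ i)]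

/-- A linear Nash game: `fⁱ(xⁱ; x⁻ⁱ) = (cⁱ + Cⁱ x⁻ⁱ)ᵀ xⁱ`, where the matrix `Cⁱ` is given by its
blocks `Cⁱⱼ`, one for every other player `j ≠ i`. -/
def IsLinear (G : NashGame κ) : Prop :=
  ∀ i, ∃ (c : κ i → ℝ) (C : (j : ι) → Matrix (κ i) (κ j) ℝ), ∀ x : (j : ι) → κ j → ℝ,
    G.cost i x = (c + ∑ j ∈ Finset.univ.erase i, C j *ᵥ x j) ⬝ᵥ x i

/-- A mixed-strategy Nash equilibrium: every `ν i` is a Borel probability distribution with finite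
support contained in the feasible set of player `i`; the players randomize independently; and no
player can lower the expected cost by a unilateral deviation to a feasible point. (All functions
are integrable with respect to a finitely supported probability distribution.) -/
structure IsMNE (G : NashGame κ) (ν : (i : ι) → Measure (κ i → ℝ)) : Prop where
  isProbabilityMeasure : ∀ i, IsProbabilityMeasure (ν i)
  finite_support : ∀ i, ∃ S : Finset (κ i → ℝ), (S : Set (κ i → ℝ)) ⊆ G.feasible i ∧
    ν i (S : Set (κ i → ℝ))ᶜ = 0
  cost_le : ∀ i, ∀ x' ∈ G.feasible i,
    ∫ x, G.cost i x ∂(Measure.pi ν) ≤ ∫ x, G.cost i (Function.update x i x') ∂(Measure.pi ν)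

end NashGame

/-- An optimization problem in `y` with a simple parameterization with respect to `x`:
`min {f(y) + (C x)ᵀ y : y ∈ F, A x + B y ≤ b}`. -/
structure SimpleParamProblem (κl κf : Type*) where
  f : (κf → ℝ) → ℝ
  C : Matrix κf κl ℝ
  F : Set (κf → ℝ)
  m : ℕ
  A : Matrix (Fin m) κl ℝ
  B : Matrix (Fin m) κf ℝ
  b : Fin m → ℝ

namespace SimpleParamProblem

variable {κl κf : Type*} [Fintype κl] [Fintype κf]

def cost (P : SimpleParamProblem κl κf) (x : κl → ℝ) (y : κf → ℝ) : ℝ :=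
  P.f y + (P.C *ᵥ x) ⬝ᵥ y

def feasible (P : SimpleParamProblem κl κf) (x : κl → ℝ) : Set (κf → ℝ) :=
  {y | y ∈ P.F ∧ P.A *ᵥ x + P.B *ᵥ y ≤ P.b}

/-- The set of optimal solutions for the parameter `x`. -/
def sol (P : SimpleParamProblem κl κf) (x : κl → ℝ) : Set (κf → ℝ) :=
  {y | y ∈ P.feasible x ∧ ∀ y' ∈ P.feasible x, P.cost x y ≤ P.cost x y'}

/-- The problem is, for every value of the parameter, a linear program. -/
def IsLinearProgram (P : SimpleParamProblem κl κf) : Prop :=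
  (∃ q : κf → ℝ, ∀ y, P.f y = q ⬝ᵥ y) ∧ IsPolyhedron P.F

end SimpleParamProblem

/-- The constraints of a Stackelberg leader with a single follower: the set of all `z = (x, y)` with
`(x, y) ∈ F` and `y ∈ SOL(P(x))`. The leader chooses both `x` and `y` (optimistic version). -/
def bilevelFeasible {κl κf : Type*} [Fintype κl] [Fintype κf]
    (F : Set (κl ⊕ κf → ℝ)) (P : SimpleParamProblem κl κf) : Set (κl ⊕ κf → ℝ) :=
  {z | z ∈ F ∧ z ∘ Sum.inr ∈ P.sol (z ∘ Sum.inl)}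

/-- A trivial NASP: a linear Nash game between two leaders, in which leader `i` controls
`z = (x, y)`, with `x ∈ ℝ^(nl i)` their own decision and `y ∈ ℝ^(nf i)` that of their follower, and
is constrained by a polyhedron and by the optimality of `y` for the follower's linear program, which
is simply parameterized in `x`. -/
structure IsTrivialNASP {nl nf : Fin 2 → ℕ}
    (G : NashGame (fun i : Fin 2 => Fin (nl i) ⊕ Fin (nf i))) : Prop where
  isLinear : G.IsLinear
  feasible_eq : ∀ i, ∃ (F : Set (Fin (nl i) ⊕ Fin (nf i) → ℝ))
    (P : SimpleParamProblem (Fin (nl i)) (Fin (nf i))),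
    IsPolyhedron F ∧ P.IsLinearProgram ∧ G.feasible i = bilevelFeasible F P

/-! The cost of a leader is linear in the own block and affine in the others, and leaders randomize
independently. Hence expected costs depend only on the means of the mixed strategies
(`integral_linear_cost`, `integral_linear_cost_update`). The means of finitely supported
distributions on a feasible set fill its convex hull (`exists_measure_of_mem_convexHull`), so it
suffices to find a pure equilibrium of the game on the convex hulls.

These hulls are compact. A follower's point is optimal exactly when, for some set of active
constraints, the cost is nonnegative on a cone of directions. Since `x` enters only the right-hand
sides and the cost, this cone does not move with `x`. The feasible set is therefore a finite union
of closed sets, and Carathéodory's theorem passes compactness to the hull.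

The equilibrium solves a variational inequality on the product of the hulls
(`exists_forall_le_of_isCompact_convex`). In place of a fixed-point theorem, a parity argument on
rooms and doors (`exists_dominant_image_eq`) is applied to finer and finer grids in a simplex. The
limit is a point supported on the indices where given continuous functions are maximal, and
compactness extends this from finitely many test points to all. -/

/-! ### A combinatorial lemma on families of linear orders -/

section Dominance

variable {T I Λ : Type*} [LinearOrder Λ]

/-- `σ` is dominant with respect to the orders in `C`: no element of `T` is, in every order
belonging to `C`, strictly above the minimum of `σ`. -/
def Dominant (r : I → T → Λ) (σ : Finset T) (C : Finset I) : Prop :=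
  ∀ y, ∃ i ∈ C, ∀ x ∈ σ, r i y ≤ r i x

theorem Dominant.mono {r : I → T → Λ} {σ τ : Finset T} {C D : Finset I} (h : Dominant r σ C)
    (hτ : τ ⊆ σ) (hC : C ⊆ D) : Dominant r τ D := fun y => by
  obtain ⟨i, hi, hy⟩ := h y
  exact ⟨i, hC hi, fun x hx => hy x (hτ hx)⟩

/-- A room of an arrangement of rooms and doors. -/
def IsRoom (r : I → T → Λ) (R : Finset T × Finset I) : Prop :=
  Dominant r R.1 R.2 ∧ R.1.card = R.2.card

theorem exists_minima (r : I → T → Λ) {τ : Finset T} (hτ : τ.Nonempty) :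
    ∃ m : I → T, ∀ i, m i ∈ τ ∧ ∀ x ∈ τ, r i (m i) ≤ r i x := by
  choose m h1 h2 using fun i => Finset.exists_min_image τ (r i) hτ
  exact ⟨m, fun i => ⟨h1 i, h2 i⟩⟩

/-- Dominance at `y = x` gives an order in which `x` lies below all of `τ`. So taking minima maps
`D` onto `τ`: bijectively for a room, with exactly one collision for a door. -/
theorem Dominant.exists_minimum_eq {r : I → T → Λ} (hr : ∀ i, Function.Injective (r i))
    {τ : Finset T} {D : Finset I} (hdom : Dominant r τ D)
    {m : I → T} (hm : ∀ i, m i ∈ τ ∧ ∀ x ∈ τ, r i (m i) ≤ r i x) {x : T} (hx : x ∈ τ) :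
    ∃ i ∈ D, m i = x := by
  obtain ⟨i, hi, h⟩ := hdom x
  exact ⟨i, hi, hr i (le_antisymm ((hm i).2 x hx) (h _ (hm i).1))⟩

variable [DecidableEq I]

/-- A surjection between finite sets whose cardinalities differ by one identifies exactly one pair. -/
theorem exists_pair_of_card_eq_add_one {τ : Finset T} {D : Finset I} (hcard : D.card = τ.card + 1)
    {m : I → T} (hm : ∀ i, m i ∈ τ) (hsurj : ∀ x ∈ τ, ∃ i ∈ D, m i = x) :
    ∃ a ∈ D, ∃ b ∈ D, a ≠ b ∧ (∀ x ∈ τ, ∃ j ∈ D.erase a, m j = x) ∧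
      (∀ x ∈ τ, ∃ j ∈ D.erase b, m j = x) ∧
      ∀ i ∈ D, (∀ x ∈ τ, ∃ j ∈ D.erase i, m j = x) → i = a ∨ i = b := by
  obtain ⟨a, ha, b, hb, hab, hmab⟩ :=
    Finset.exists_ne_map_eq_of_card_lt_of_maps_to (s := D) (t := τ) (by omega) (f := m)
      (fun i _ => hm i)
  have key : ∀ a ∈ D, ∀ b ∈ D, a ≠ b → m a = m b → ∀ x ∈ τ, ∃ j ∈ D.erase a, m j = x := by
    intro a ha b hb hab hmab x hx
    obtain ⟨i, hi, hix⟩ := hsurj x hx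
    by_cases hia : i = a
    · exact ⟨b, Finset.mem_erase.2 ⟨hab.symm, hb⟩, by rw [← hmab, ← hia, hix]⟩
    · exact ⟨i, Finset.mem_erase.2 ⟨hia, hi⟩, hix⟩
  -- After one erasure the cardinalities agree, so the surjection is injective. Erasing an index
  -- other than `a` and `b` would leave the collision `m a = m b`.
  have hinj : ∀ a ∈ D, (∀ x ∈ τ, ∃ j ∈ D.erase a, m j = x) →
      ∀ i ∈ D.erase a, ∀ j ∈ D.erase a, m i = m j → i = j := by
    intro a ha hs i hi j hj hij
    exact Finset.inj_on_of_surj_on_of_card_le (s := D.erase a) (t := τ) (fun i _ => m i)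
      (fun i _ => hm i) (fun x hx => by obtain ⟨j, hj, h⟩ := hs x hx; exact ⟨j, hj, h⟩)
      (by rw [Finset.card_erase_of_mem ha]; omega) hi hj hij
  have hsa := key a ha b hb hab hmab
  have hsb := key b hb a ha hab.symm hmab.symm
  refine ⟨a, ha, b, hb, hab, hsa, hsb, fun i hi hs => ?_⟩
  by_contra! hcon
  refine hab (hinj i hi hs a ?_ b ?_ hmab)
  · exact Finset.mem_erase.2 ⟨hcon.1.symm, ha⟩
  · exact Finset.mem_erase.2 ⟨hcon.2.symm, hb⟩

variable [DecidableEq T]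

/-- `d` is a door of the room `R`. -/
def IsDoorOf (R d : Finset T × Finset I) : Prop :=
  (R.2 = d.2 ∧ ∃ x ∈ R.1, d.1 = R.1.erase x) ∨ (R.1 = d.1 ∧ ∃ i ∉ R.2, d.2 = insert i R.2)

theorem IsDoorOf.dominant {r : I → T → Λ} {R d : Finset T × Finset I} (h : IsDoorOf R d)
    (hR : IsRoom r R) : Dominant r d.1 d.2 := by
  rcases h with ⟨h1, x, hx, h2⟩ | ⟨h1, i, hi, h2⟩
  · exact hR.1.mono (h2 ▸ Finset.erase_subset _ _) h1.subset
  · exact hR.1.mono h1.symm.subset (h2 ▸ Finset.subset_insert _ _)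

theorem IsDoorOf.card_eq {r : I → T → Λ} {R d : Finset T × Finset I} (h : IsDoorOf R d)
    (hR : IsRoom r R) : d.2.card = d.1.card + 1 := by
  have h0 := hR.2
  rcases h with ⟨h1, x, hx, h2⟩ | ⟨h1, i, hi, h2⟩
  · rw [h2, ← h1, Finset.card_erase_add_one hx, h0]
  · rw [h2, ← h1, Finset.card_insert_of_notMem hi, h0]

/-- The rooms behind a door whose first component is empty. -/
theorem existsUnique_room_of_empty [Fintype T] [Nonempty T] {r : I → T → Λ}
    (hr : ∀ i, Function.Injective (r i)) (i : I) :
    ∃! R : Finset T × Finset I, IsRoom r R ∧ IsDoorOf R (∅, {i}) := by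
  obtain ⟨x, -, hx⟩ := Finset.exists_max_image Finset.univ (r i) Finset.univ_nonempty
  refine ⟨({x}, {i}), ⟨⟨fun y => ⟨i, by simp, fun z hz => ?_⟩, by simp⟩, Or.inl ⟨rfl, x, by simp⟩⟩,
    ?_⟩
  · rw [Finset.mem_singleton.1 hz]
    exact hx y (Finset.mem_univ _)
  · rintro ⟨σ, C⟩ ⟨hR, ⟨h1, z, hz, h2⟩ | ⟨h1, j, hj, h2⟩⟩
    · simp only at h1 h2 hz
      subst h1
      have hσ : σ = {z} := by
        rw [← Finset.insert_erase hz, ← h2]; rfl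
      subst hσ
      obtain ⟨j, hj, hjz⟩ := hR.1 x
      rw [Finset.mem_singleton] at hj
      subst hj
      have := hr j (le_antisymm (hjz z (by simp)) (hx z (Finset.mem_univ _)))
      rw [this]
    · have hc := hR.2
      simp only at h1 hc
      subst h1
      rw [Finset.card_empty, eq_comm, Finset.card_eq_zero] at hc
      subst hc
      obtain ⟨k, hk, -⟩ := hR.1 x
      simp at hk

/-- Given the minima `m` of `τ` and an order `i` that is not needed to list `τ`, there is exactly one
room obtained from the door `(τ, D)` by giving up the order `i`, or the minimum with respect to
`i`. -/
theorem existsUnique_room_of_minima [Fintype T] {r : I → T → Λ}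
    (hr : ∀ i, Function.Injective (r i)) {τ : Finset T} {D : Finset I} (hdom : Dominant r τ D)
    {m : I → T} (hm : ∀ i, m i ∈ τ ∧ ∀ x ∈ τ, r i (m i) ≤ r i x) {i : I} (hi : i ∈ D)
    (hsurj : ∀ x ∈ τ, ∃ j ∈ D.erase i, m j = x) :
    ∃! R : Finset T × Finset I, (R = (τ, D.erase i) ∧ Dominant r τ (D.erase i)) ∨
      ∃ x, (∀ j ∈ D.erase i, r j (m j) < r j x) ∧ R = (insert x τ, D) ∧
        Dominant r (insert x τ) D := by
  -- The points of `M` refute dominance of `(τ, D.erase i)`. If there are any, the only one that can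
  -- be added to `τ` is the largest for `r i`.
  set M : Finset T := Finset.univ.filter fun y => ∀ j ∈ D.erase i, r j (m j) < r j y with hM
  have hdomE : Dominant r τ (D.erase i) ↔ M = ∅ := by
    constructor
    · intro h
      refine Finset.eq_empty_of_forall_notMem fun y hy => ?_
      obtain ⟨j, hj, hjy⟩ := h y
      exact absurd (hjy _ (hm j).1) (not_le.2 ((Finset.mem_filter.1 hy).2 j hj))
    · intro h y
      by_contra! hcon
      have : y ∈ M := Finset.mem_filter.2 ⟨Finset.mem_univ _, fun j hj => by
        obtain ⟨x, hx, hxy⟩ := hcon j hj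
        exact ((hm j).2 x hx).trans_lt hxy⟩
      simp [h] at this
  -- As `(τ, D)` is dominant, only the order `i` can hold back a point of `M`.
  have hlow : ∀ y, (∀ j ∈ D.erase i, r j (m j) < r j y) → ∀ x ∈ τ, r i y ≤ r i x := by
    intro y hy
    obtain ⟨j, hj, hjy⟩ := hdom y
    by_cases hji : j = i
    · exact hji ▸ hjy
    · exact absurd (hjy _ (hm j).1) (not_le.2 (hy j (Finset.mem_erase.2 ⟨hji, hj⟩)))
  by_cases hMe : M = ∅
  · refine ⟨_, Or.inl ⟨rfl, hdomE.2 hMe⟩, ?_⟩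
    rintro R (⟨h, -⟩ | ⟨x, hx, -, -⟩)
    · exact h
    · have : x ∈ M := Finset.mem_filter.2 ⟨Finset.mem_univ _, hx⟩
      simp [hMe] at this
  · obtain ⟨x, hxM, hx⟩ := Finset.exists_max_image M (r i) (Finset.nonempty_iff_ne_empty.2 hMe)
    have hx' := (Finset.mem_filter.1 hxM).2
    refine ⟨(insert x τ, D), Or.inr ⟨x, hx', rfl, fun y => ?_⟩, ?_⟩
    · by_cases hy : y ∈ M
      · refine ⟨i, hi, fun z hz => ?_⟩
        rcases Finset.mem_insert.1 hz with rfl | hz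
        · exact hx y hy
        · exact (hx y hy).trans (hlow x hx' z hz)
      · have : ∃ j ∈ D.erase i, r j y ≤ r j (m j) := by
          by_contra! hcon
          exact hy (Finset.mem_filter.2 ⟨Finset.mem_univ _, hcon⟩)
        obtain ⟨j, hj, hjy⟩ := this
        refine ⟨j, Finset.mem_of_mem_erase hj, fun z hz => ?_⟩
        rcases Finset.mem_insert.1 hz with rfl | hz
        · exact hjy.trans (hx' j hj).le
        · exact hjy.trans ((hm j).2 z hz)
    · rintro R (⟨-, h⟩ | ⟨z, hz, rfl, hdz⟩)
      · exact absurd (hdomE.1 h) hMe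
      · have hzM : z ∈ M := Finset.mem_filter.2 ⟨Finset.mem_univ _, hz⟩
        obtain ⟨j, hj, hjx⟩ := hdz x
        have hji : j = i := by
          by_contra hji
          exact absurd (hjx _ (Finset.mem_insert_of_mem (hm j).1))
            (not_le.2 (hx' j (Finset.mem_erase.2 ⟨hji, hj⟩)))
        subst hji
        rw [hr j (le_antisymm (hjx z (Finset.mem_insert_self _ _)) (hx z hzM))]

/-- A door with nonempty first component leads to exactly two rooms. -/
theorem exists_two_rooms [Fintype T] {r : I → T → Λ}
    (hr : ∀ i, Function.Injective (r i)) {τ : Finset T} {D : Finset I} (hdom : Dominant r τ D)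
    (hcard : D.card = τ.card + 1) (hτ : τ.Nonempty) :
    ∃ R₁ R₂ : Finset T × Finset I, R₁ ≠ R₂ ∧
      ∀ R, IsRoom r R ∧ IsDoorOf R (τ, D) ↔ R = R₁ ∨ R = R₂ := by
  obtain ⟨m, hm⟩ := exists_minima r hτ
  obtain ⟨a, ha, b, hb, hab, hsa, hsb, hpair⟩ := exists_pair_of_card_eq_add_one hcard
    (fun i => (hm i).1) (fun x hx => hdom.exists_minimum_eq hr hm hx)
  have fwd : ∀ i ∈ D, (∀ x ∈ τ, ∃ j ∈ D.erase i, m j = x) → ∀ R : Finset T × Finset I,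
      ((R = (τ, D.erase i) ∧ Dominant r τ (D.erase i)) ∨
      ∃ x, (∀ j ∈ D.erase i, r j (m j) < r j x) ∧ R = (insert x τ, D) ∧
        Dominant r (insert x τ) D) → IsRoom r R ∧ IsDoorOf R (τ, D) := by
    rintro i hi hs R (⟨rfl, h⟩ | ⟨x, hx, rfl, h⟩)
    · refine ⟨⟨h, ?_⟩, Or.inr ⟨rfl, i, by simp, ?_⟩⟩
      · simp only [Finset.card_erase_of_mem hi]; omega
      · exact (Finset.insert_erase hi).symm
    · have hxτ : x ∉ τ := fun hxτ => by
        obtain ⟨j, hj, rfl⟩ := hs x hxτ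
        exact lt_irrefl _ (hx j hj)
      refine ⟨⟨h, ?_⟩, Or.inl ⟨rfl, x, by simp, ?_⟩⟩
      · simp only [Finset.card_insert_of_notMem hxτ]; omega
      · exact (Finset.erase_insert hxτ).symm
  have bwd : ∀ R : Finset T × Finset I, IsRoom r R → IsDoorOf R (τ, D) →
      ∃ i, (i = a ∨ i = b) ∧ ((R = (τ, D.erase i) ∧ Dominant r τ (D.erase i)) ∨
      ∃ x, (∀ j ∈ D.erase i, r j (m j) < r j x) ∧ R = (insert x τ, D) ∧
        Dominant r (insert x τ) D) := by
    rintro ⟨σ, C⟩ hR (⟨h1, x, hx, h2⟩ | ⟨h1, i, hi, h2⟩)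
    · simp only at h1 h2 hx
      subst h1
      have hσ : σ = insert x τ := by rw [h2, Finset.insert_erase hx]
      have hxτ : x ∉ τ := by rw [h2]; simp
      subst hσ
      have hdR : Dominant r (insert x τ) C := hR.1
      -- In a room distinct orders have distinct minima. If `x` is the minimum for `i`, the other
      -- orders have theirs in `τ`, so `i` is redundant for `τ` and must be `a` or `b`.
      obtain ⟨i, hi, hix⟩ := hdR x
      obtain ⟨m', hm'⟩ := exists_minima r (Finset.insert_nonempty x τ)
      have hinj : ∀ j ∈ C, ∀ k ∈ C, m' j = m' k → j = k := fun j hj k hk hjk =>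
        Finset.inj_on_of_surj_on_of_card_le (s := C) (t := insert x τ) (fun i _ => m' i)
          (fun i _ => (hm' i).1) (fun x hx => by
            obtain ⟨j, hj, h⟩ := hdR.exists_minimum_eq hr hm' hx; exact ⟨j, hj, h⟩)
          hR.2.ge hj hk hjk
      have hm'i : m' i = x :=
        hr i (le_antisymm ((hm' i).2 x (by simp)) (hix _ (hm' i).1))
      have hm'j : ∀ j ∈ C.erase i, m' j = m j ∧ r j (m j) < r j x := by
        intro j hj
        have hne : m' j ≠ x := fun h =>
          Finset.ne_of_mem_erase hj (hinj j (Finset.mem_of_mem_erase hj) i hi (h.trans hm'i.symm))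
        have hjτ : m' j ∈ τ := (Finset.mem_insert.1 (hm' j).1).resolve_left hne
        have heq : m' j = m j := hr j (le_antisymm ((hm' j).2 _ (Finset.mem_insert_of_mem (hm j).1))
          ((hm j).2 _ hjτ))
        refine ⟨heq, lt_of_le_of_ne (heq ▸ (hm' j).2 x (by simp)) fun h => hne ?_⟩
        rw [heq]; exact hr j h
      refine ⟨i, hpair i hi fun y hy => ?_, Or.inr ⟨x, fun j hj => (hm'j j hj).2, rfl, hdR⟩⟩
      obtain ⟨j, hj, hjy⟩ := hdR.exists_minimum_eq hr hm' (Finset.mem_insert_of_mem hy)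
      have hji : j ≠ i := by
        rintro rfl
        exact hxτ (hm'i ▸ hjy ▸ hy)
      have hj' := Finset.mem_erase.2 ⟨hji, hj⟩
      exact ⟨j, hj', (hm'j j hj').1 ▸ hjy⟩
    · simp only at h1 h2 hi
      subst h1
      have hC : C = D.erase i := by rw [h2, Finset.erase_insert hi]
      have hiD : i ∈ D := by rw [h2]; simp
      subst hC
      exact ⟨i, hpair i hiD fun y hy => hR.1.exists_minimum_eq hr hm hy, Or.inl ⟨rfl, hR.1⟩⟩
  obtain ⟨Ra, hRa, hua⟩ := existsUnique_room_of_minima hr hdom hm ha hsa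
  obtain ⟨Rb, hRb, hub⟩ := existsUnique_room_of_minima hr hdom hm hb hsb
  refine ⟨Ra, Rb, ?_, fun R => ⟨?_, ?_⟩⟩
  · rintro rfl
    rcases hRa with ⟨h, -⟩ | ⟨x, hx, h, -⟩ <;> rcases hRb with ⟨h', -⟩ | ⟨x', hx', h', -⟩
    · rw [h, Prod.mk.injEq] at h'
      have : a ∈ D.erase a := h'.2 ▸ Finset.mem_erase.2 ⟨hab, ha⟩
      simp at this
    · rw [h, Prod.mk.injEq] at h'
      have : a ∈ D.erase a := (Finset.ext_iff.1 h'.2 a).2 ha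
      simp at this
    · rw [h, Prod.mk.injEq] at h'
      have : b ∈ D.erase b := h'.2 ▸ hb
      simp at this
    · rw [h, Prod.mk.injEq] at h'
      have hxτ : x ∉ τ := fun hxτ => by
        obtain ⟨j, hj, rfl⟩ := hsa x hxτ
        exact lt_irrefl _ (hx j hj)
      have hxx : x = x' := by
        have : x ∈ insert x' τ := h'.1 ▸ Finset.mem_insert_self _ _
        exact (Finset.mem_insert.1 this).resolve_right hxτ
      subst hxx
      -- The common point lies above the minimum of `τ` in every order except `a`, and in every
      -- order except `b`, hence in all of them.
      obtain ⟨j, hj, hjx⟩ := hdom x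
      have hja : j = a := by
        by_contra hne
        exact absurd (hjx _ (hm j).1) (not_le.2 (hx j (Finset.mem_erase.2 ⟨hne, hj⟩)))
      have hjb : j = b := by
        by_contra hne
        exact absurd (hjx _ (hm j).1) (not_le.2 (hx' j (Finset.mem_erase.2 ⟨hne, hj⟩)))
      exact hab (hja ▸ hjb)
  · rintro ⟨h1, h2⟩
    obtain ⟨i, rfl | rfl, h⟩ := bwd R h1 h2
    · exact Or.inl (hua R h)
    · exact Or.inr (hub R h)
  · rintro (rfl | rfl)
    · exact fwd a ha hsa _ hRa
    · exact fwd b hb hsb _ hRb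

/-- The colours of `σ` are distinct: those of `C` with `i₀` replaced by a foreign `j`. Colours and
orders agree up to `i₀` only if the point coloured `j` is dropped or the order `j` is admitted. -/
theorem two_doors_of_color_notMem {c : T → I} {i₀ j : I} {σ : Finset T} {C : Finset I}
    (hcard : σ.card = C.card) (hi₀ : i₀ ∈ C) (hj : j ∉ C) (hc : σ.image c = insert j (C.erase i₀))
    {x : T} (hx : x ∈ σ) (hcx : c x = j) (e : Finset T × Finset I) :
    (IsDoorOf (σ, C) e ∧ i₀ ∈ e.2 ∧ e.1.image c = e.2.erase i₀) ↔
      e = (σ.erase x, C) ∨ e = (σ, insert j C) := by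
  have hji : j ≠ i₀ := fun h => hj (h ▸ hi₀)
  have hinj : Set.InjOn c σ := Finset.card_image_iff.1 (by
    rw [hc, Finset.card_insert_of_notMem (fun h => hj (Finset.mem_of_mem_erase h)),
      Finset.card_erase_add_one hi₀, hcard])
  have hcj : (insert j C).erase i₀ = insert j (C.erase i₀) := Finset.erase_insert_of_ne hji
  constructor
  · rcases e with ⟨τ, D⟩
    rintro ⟨⟨h1, z, hz, h2⟩ | ⟨h1, k, hk, h2⟩, hi, hce⟩ <;> simp only at h1 h2 hi hce
    · subst h1 h2
      left
      by_cases hzx : z = x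
      · rw [hzx]
      · have : c x ∈ (σ.erase z).image c :=
          Finset.mem_image_of_mem c (Finset.mem_erase.2 ⟨Ne.symm hzx, hx⟩)
        rw [hce, hcx] at this
        exact absurd (Finset.mem_of_mem_erase this) hj
    · subst h1 h2
      right
      have : j ∈ (insert k C).erase i₀ := by rw [← hce, hc]; simp
      have hjk := (Finset.mem_insert.1 (Finset.mem_of_mem_erase this)).resolve_right hj
      rw [hjk]
  · rintro (rfl | rfl)
    · refine ⟨Or.inl ⟨rfl, x, hx, rfl⟩, hi₀, ?_⟩
      ext k
      have hk := Finset.ext_iff.1 hc k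
      simp only [Finset.mem_image, Finset.mem_insert, Finset.mem_erase] at hk ⊢
      constructor
      · rintro ⟨y, ⟨hyx, hy⟩, rfl⟩
        refine (hk.1 ⟨y, hy, rfl⟩).resolve_left fun h => hyx (hinj hy hx (h.trans hcx.symm))
      · intro h
        obtain ⟨y, hy, rfl⟩ := hk.2 (Or.inr h)
        refine ⟨y, ⟨fun hyx => hj ?_, hy⟩, rfl⟩
        rw [← hcx, ← hyx]
        exact h.2
    · exact ⟨Or.inr ⟨rfl, j, hj, rfl⟩, Finset.mem_insert_of_mem hi₀, hc.trans hcj.symm⟩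

/-- The colours of `σ` are those of `C.erase i₀`, with one repetition, at `x` and `x'`. A new order
would need a new colour, so one of the two points must be dropped. -/
theorem two_doors_of_color_mem {c : T → I} {i₀ : I} {σ : Finset T} {C : Finset I}
    (hcard : σ.card = C.card) (hi₀ : i₀ ∈ C) {x x' : T} (hx : x ∈ σ) (hx' : x' ∈ σ) (hne : x ≠ x')
    (hcx : c x = c x') (hc : (σ.erase x).image c = C.erase i₀) (e : Finset T × Finset I) :
    (IsDoorOf (σ, C) e ∧ i₀ ∈ e.2 ∧ e.1.image c = e.2.erase i₀) ↔
      e = (σ.erase x, C) ∨ e = (σ.erase x', C) := by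
  have hinj : Set.InjOn c (σ.erase x) := Finset.card_image_iff.1 (by
    rw [hc, Finset.card_erase_of_mem hi₀, Finset.card_erase_of_mem hx, hcard])
  have himg : σ.image c = C.erase i₀ := by
    rw [← Finset.insert_erase hx, Finset.image_insert, hc, Finset.insert_eq_self, hcx, ← hc]
    exact Finset.mem_image_of_mem c (Finset.mem_erase.2 ⟨hne.symm, hx'⟩)
  constructor
  · rcases e with ⟨τ, D⟩
    rintro ⟨⟨h1, z, hz, h2⟩ | ⟨h1, k, hk, h2⟩, hi, hce⟩ <;> simp only at h1 h2 hi hce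
    · subst h1 h2
      by_cases hzx : z = x
      · rw [hzx]; exact Or.inl rfl
      · right
        have : c z ∈ (σ.erase z).image c := by
          rw [hce, ← himg]; exact Finset.mem_image_of_mem c hz
        obtain ⟨y, hy, hyz⟩ := Finset.mem_image.1 this
        rw [Finset.mem_erase] at hy
        by_cases hyx : y = x
        · subst hyx
          rw [hinj (Finset.mem_coe.2 (Finset.mem_erase.2 ⟨hzx, hz⟩))
            (Finset.mem_coe.2 (Finset.mem_erase.2 ⟨hne.symm, hx'⟩)) (hyz.symm.trans hcx)]
        · exact absurd (hinj (Finset.mem_coe.2 (Finset.mem_erase.2 ⟨hyx, hy.2⟩))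
            (Finset.mem_coe.2 (Finset.mem_erase.2 ⟨hzx, hz⟩)) hyz) hy.1
    · subst h1 h2
      rw [himg, Finset.erase_insert_of_ne (by rintro rfl; exact hk hi₀)] at hce
      have : k ∈ C.erase i₀ := hce ▸ Finset.mem_insert_self _ _
      exact absurd (Finset.mem_of_mem_erase this) hk
  · rintro (rfl | rfl)
    · exact ⟨Or.inl ⟨rfl, x, hx, rfl⟩, hi₀, hc⟩
    · refine ⟨Or.inl ⟨rfl, x', hx', rfl⟩, hi₀, ?_⟩
      rw [← himg]
      refine (Finset.image_subset_image (Finset.erase_subset _ _)).antisymm fun k hk => ?_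
      obtain ⟨y, hy, rfl⟩ := Finset.mem_image.1 hk
      by_cases hyx : y = x'
      · rw [hyx, ← hcx]
        exact Finset.mem_image_of_mem c (Finset.mem_erase.2 ⟨hne, hx⟩)
      · exact Finset.mem_image_of_mem c (Finset.mem_erase.2 ⟨hyx, hy⟩)

/-- If `(σ, C)` is a room with `c(σ) ≠ C` that has a door `d` with `c(d.1) = d.2 \ {i₀}`, then it has
exactly two such doors. -/
theorem exists_two_doors {c : T → I} {i₀ : I} {R : Finset T × Finset I}
    (hR : R.1.card = R.2.card) (hc : R.1.image c ≠ R.2) {d : Finset T × Finset I}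
    (hd : IsDoorOf R d) (hi₀ : i₀ ∈ d.2) (hdc : d.1.image c = d.2.erase i₀) :
    ∃ d₁ d₂, d₁ ≠ d₂ ∧
      ∀ e, (IsDoorOf R e ∧ i₀ ∈ e.2 ∧ e.1.image c = e.2.erase i₀) ↔ e = d₁ ∨ e = d₂ := by
  rcases R with ⟨σ, C⟩
  rcases d with ⟨τ, D⟩
  rcases hd with ⟨h1, x, hx, h2⟩ | ⟨h1, j, hj, h2⟩ <;> simp only at h1 h2 hi₀ hdc hc hR
  · subst h1 h2
    have himg : σ.image c = insert (c x) (C.erase i₀) := by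
      rw [← hdc, ← Finset.image_insert, Finset.insert_erase hx]
    have hcx : c x ≠ i₀ := fun h => hc (by rw [himg, h, Finset.insert_erase hi₀])
    by_cases hxC : c x ∈ C
    · have : c x ∈ (σ.erase x).image c := hdc ▸ Finset.mem_erase.2 ⟨hcx, hxC⟩
      obtain ⟨x', hx', hxx'⟩ := Finset.mem_image.1 this
      rw [Finset.mem_erase] at hx'
      refine ⟨_, _, fun h => ?_,
        two_doors_of_color_mem hR hi₀ hx hx'.2 hx'.1.symm hxx'.symm hdc⟩
      have h' := (Prod.mk.inj h).1
      have : x' ∈ σ.erase x' := h' ▸ Finset.mem_erase.2 hx'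
      simp at this
    · refine ⟨_, _, fun h => ?_, two_doors_of_color_notMem hR hi₀ hxC himg hx rfl⟩
      have : x ∈ σ.erase x := (Prod.mk.inj h).1.symm ▸ hx
      simp at this
  · subst h1 h2
    have hji : j ≠ i₀ := by
      rintro rfl
      exact hc (by rw [hdc, Finset.erase_insert hj])
    rw [Finset.erase_insert_of_ne hji] at hdc
    have : j ∈ σ.image c := hdc ▸ Finset.mem_insert_self _ _
    obtain ⟨x, hx, hcx⟩ := Finset.mem_image.1 this
    refine ⟨_, _, fun h => ?_, two_doors_of_color_notMem hR
      ((Finset.mem_insert.1 hi₀).resolve_left hji.symm) hj hdc hx hcx⟩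
    have : x ∈ σ.erase x := (Prod.mk.inj h).1.symm ▸ hx
    simp at this

theorem Finset.card_filter_eq_two {α : Type*} [DecidableEq α] {s : Finset α} {p : α → Prop}
    [DecidablePred p] {a b : α} (hab : a ≠ b) (h : ∀ x, x ∈ s ∧ p x ↔ x = a ∨ x = b) :
    (s.filter p).card = 2 := by
  rw [show s.filter p = {a, b} by ext x; simpa using h x, Finset.card_pair hab]

/-- A version of Scarf's lemma: for every colouring there is a room that is coloured by exactly its
own orders. -/
theorem exists_dominant_image_eq [Fintype T] [Nonempty T] [Fintype I] [Nonempty I] {r : I → T → Λ}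
    (hr : ∀ i, Function.Injective (r i)) (c : T → I) :
    ∃ (σ : Finset T) (C : Finset I), Dominant r σ C ∧ σ.card = C.card ∧ σ.image c = C := by
  classical
  by_contra! hno
  obtain ⟨i₀⟩ := ‹Nonempty I›
  let rooms : Finset (Finset T × Finset I) := Finset.univ.filter (IsRoom r)
  let doors : Finset (Finset T × Finset I) := Finset.univ.filter fun d =>
    Dominant r d.1 d.2 ∧ d.2.card = d.1.card + 1 ∧ i₀ ∈ d.2 ∧ d.1.image c = d.2.erase i₀
  have hdoors : ∀ d, d ∈ doors ↔ Dominant r d.1 d.2 ∧ d.2.card = d.1.card + 1 ∧ i₀ ∈ d.2 ∧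
    d.1.image c = d.2.erase i₀ := fun d => by simp [doors]
  have hrooms : ∀ R, R ∈ rooms ↔ IsRoom r R := fun R => by simp [rooms]
  -- Incidences are counted modulo 2, using only doors whose points show exactly the colours of
  -- their orders other than `i₀`. If the claim failed, each room would have zero or two such doors,
  -- while each door has two rooms, except `(∅, {i₀})`, which has one.
  have hcount := Finset.sum_card_bipartiteAbove_eq_sum_card_bipartiteBelow (s := rooms)
    (t := doors) IsDoorOf
  have heven : Even (∑ R ∈ rooms, (doors.bipartiteAbove IsDoorOf R).card) := by
    refine Finset.even_sum _ fun R hR => ?_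
    rw [hrooms] at hR
    by_cases hne : (doors.bipartiteAbove IsDoorOf R).Nonempty
    · obtain ⟨d, hd⟩ := hne
      rw [Finset.mem_bipartiteAbove, hdoors] at hd
      obtain ⟨d₁, d₂, hne, h⟩ := exists_two_doors hR.2 (hno R.1 R.2 hR.1 hR.2) hd.2 hd.1.2.2.1
        hd.1.2.2.2
      rw [Finset.bipartiteAbove, Finset.card_filter_eq_two hne fun e => ?_]
      · exact even_two
      · rw [← h, hdoors]
        exact ⟨fun ⟨⟨_, _, h3, h4⟩, h5⟩ => ⟨h5, h3, h4⟩,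
          fun ⟨h5, h3, h4⟩ => ⟨⟨h5.dominant hR, h5.card_eq hR, h3, h4⟩, h5⟩⟩
    · rw [Finset.not_nonempty_iff_eq_empty.1 hne]
      simp
  have hd₀ : ((∅, {i₀}) : Finset T × Finset I) ∈ doors := by
    rw [hdoors]
    exact ⟨fun y => ⟨i₀, by simp⟩, by simp, by simp, by simp⟩
  have hodd : Odd (∑ d ∈ doors, (rooms.bipartiteBelow IsDoorOf d).card) := by
    rw [← Finset.add_sum_erase _ _ hd₀]
    refine Odd.add_even ?_ (Finset.even_sum _ fun d hd => ?_)
    · obtain ⟨R, hR, hu⟩ := existsUnique_room_of_empty hr i₀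
      have : rooms.bipartiteBelow IsDoorOf (∅, {i₀}) = {R} := by
        ext R'
        rw [Finset.mem_bipartiteBelow, hrooms, Finset.mem_singleton]
        exact ⟨fun h => hu R' h, fun h => h ▸ hR⟩
      rw [this, Finset.card_singleton]
      exact odd_one
    · rw [Finset.mem_erase, hdoors] at hd
      obtain ⟨hne, hdom, hcard, hi, hc⟩ := hd
      have hτ : d.1.Nonempty := by
        rw [Finset.nonempty_iff_ne_empty]
        intro h
        rw [h, Finset.image_empty, eq_comm, Finset.erase_eq_empty_iff] at hc
        refine hne (Prod.ext h (hc.resolve_left fun h' => ?_))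
        simp [h'] at hi
      obtain ⟨R₁, R₂, hR, h⟩ := exists_two_rooms hr hdom hcard hτ
      rw [Finset.bipartiteBelow, Finset.card_filter_eq_two hR fun R => by rw [hrooms]; exact h R]
      exact even_two
  rw [← hcount] at hodd
  exact (Nat.not_even_iff_odd.2 hodd) heven

end Dominance

/-! ### Complementary points of continuous functions on the simplex -/

section Simplex

open Filter Topology

/-- A colouring of the grid points of a simplex has a small almost fully coloured set. -/
theorem exists_colored_grid_points {I : Type*} [Fintype I] [Nonempty I] [DecidableEq I] (N : ℕ)
    (c : (I → ℕ) → I) :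
    ∃ (C : Finset I) (m : I → ℕ) (p : I → I → ℕ), C.Nonempty ∧ (∀ k ∉ C, m k = 0) ∧
      ∀ i ∈ C, ∑ k, p i k = N ∧ c (p i) = i ∧
        ∀ k, m k ≤ p i k ∧ p i k ≤ m k + Fintype.card I := by
  classical
  obtain ⟨i₀⟩ := id ‹Nonempty I›
  let T := Finset.piAntidiag (Finset.univ : Finset I) N
  have hT : ∀ x : I → ℕ, x ∈ Finset.piAntidiag Finset.univ N ↔ ∑ k, x k = N := fun x => by
    simp [Finset.mem_piAntidiag]
  have : Nonempty T := ⟨⟨Pi.single i₀ N, (hT _).2 (by simp)⟩⟩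
  -- An enumeration of the grid breaks ties between equal coordinates, which makes each `r i`
  -- injective.
  let e := Fintype.equivFin T
  let r : I → T → ℕ ×ₗ Fin (Fintype.card T) := fun i x => toLex (x.1 i, e x)
  have hr : ∀ i, Function.Injective (r i) := fun i x y h => by
    have := congrArg (fun z => (ofLex z).2) h
    exact e.injective this
  have hle : ∀ i x y, r i x ≤ r i y → x.1 i ≤ y.1 i := fun i x y h => by
    rcases Prod.Lex.toLex_le_toLex.1 h with h | h
    · exact h.le
    · exact h.1.le
  obtain ⟨σ, C, hdom, hcard, hc⟩ := exists_dominant_image_eq hr (fun x : T => c x.1)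
  have hC : C.Nonempty := by
    obtain ⟨i, hi, -⟩ := hdom (Classical.arbitrary T)
    exact ⟨i, hi⟩
  have hσ : σ.Nonempty := by rwa [← Finset.card_pos, hcard, Finset.card_pos]
  obtain ⟨μ, hμ⟩ := exists_minima (fun i (x : T) => x.1 i) hσ
  set m : I → ℕ := fun k => if k ∈ C then (μ k).1 k else 0 with hm
  have hml : ∀ x ∈ σ, ∀ k, m k ≤ x.1 k := fun x hx k => by
    by_cases hk : k ∈ C
    · simpa [hm, hk] using (hμ k).2 x hx
    · simp [hm, hk]
  -- Otherwise the grid point with coordinates `m k + 1` on `C` and the surplus put at `k₀` would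
  -- exceed every minimum, against dominance.
  have hsum : N < ∑ k, m k + C.card := by
    by_contra! hcon
    obtain ⟨k₀, hk₀⟩ := hC
    let y : I → ℕ := fun k => (m k + if k ∈ C then 1 else 0) +
      if k = k₀ then N - (∑ k, m k + C.card) else 0
    have hy : ∑ k, y k = N := by
      simp only [y, Finset.sum_add_distrib, Finset.sum_ite_mem, Finset.univ_inter,
        Finset.sum_const, Finset.sum_ite_eq', Finset.mem_univ, if_true, smul_eq_mul, mul_one]
      omega
    obtain ⟨i, hi, h⟩ := hdom ⟨y, (hT _).2 hy⟩
    have h1 := hle i _ _ (h (μ i) (hμ i).1)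
    simp only [y, hm, hi, if_true] at h1
    omega
  -- The other coordinates are at least those of `m`, which leaves less than `m k + C.card` for
  -- coordinate `k`.
  have hup : ∀ x ∈ σ, ∀ k, x.1 k ≤ m k + Fintype.card I := fun x hx k => by
    have h1 : ∑ j, x.1 j = N := (hT _).1 x.2
    rw [← Finset.add_sum_erase _ _ (Finset.mem_univ k)] at h1 hsum
    have h2 := Finset.sum_le_sum fun j (_ : j ∈ Finset.univ.erase k) => hml x hx j
    have h3 := Finset.card_le_univ C
    omega
  have hp : ∀ i, ∃ x : T, i ∈ C → x ∈ σ ∧ c x.1 = i := fun i => by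
    by_cases hi : i ∈ C
    · rw [← hc] at hi
      obtain ⟨x, hx, hxi⟩ := Finset.mem_image.1 hi
      exact ⟨x, fun _ => ⟨hx, hxi⟩⟩
    · exact ⟨Classical.arbitrary T, fun h => absurd h hi⟩
  choose p hp using hp
  exact ⟨C, m, fun i => (p i).1, hC, fun k hk => by simp [hm, hk], fun i hi =>
    ⟨(hT _).1 (p i).2, (hp i hi).2, fun k => ⟨hml _ (hp i hi).1 k, hup _ (hp i hi).1 k⟩⟩⟩

/-- Each grid point is coloured by an index maximizing `g` there. The grid has order `N + 1` to keep
the mesh finite at `N = 0`. -/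
theorem exists_almost_complementary {I : Type*} [Fintype I] [Nonempty I] (g : I → (I → ℝ) → ℝ)
    (N : ℕ) :
    ∃ (C : Finset I) (p : I → I → ℝ), C.Nonempty ∧ ∀ i ∈ C, p i ∈ stdSimplex ℝ I ∧
      (∀ k, g k (p i) ≤ g i (p i)) ∧ (∀ k ∉ C, p i k ≤ Fintype.card I / ((N : ℝ) + 1)) ∧
      ∀ j ∈ C, dist (p i) (p j) ≤ Fintype.card I / ((N : ℝ) + 1) := by
  classical
  have hN : (0 : ℝ) < (N : ℝ) + 1 := by positivity
  have hmax : ∀ x : I → ℕ, ∃ i, ∀ k, g k (fun j => x j / ((N : ℝ) + 1)) ≤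
      g i (fun j => x j / ((N : ℝ) + 1)) := fun x => by
    obtain ⟨i, hi⟩ := Finite.exists_max fun k => g k (fun j => x j / ((N : ℝ) + 1))
    exact ⟨i, hi⟩
  choose c hc using hmax
  obtain ⟨C, m, p, hC, hm, hp⟩ := exists_colored_grid_points (N + 1) c
  refine ⟨C, fun i j => p i j / ((N : ℝ) + 1), hC, fun i hi => ⟨⟨fun k => by positivity, ?_⟩,
    fun k => ?_, fun k hk => ?_, fun j hj => ?_⟩⟩
  · rw [← Finset.sum_div, div_eq_one_iff_eq hN.ne']
    exact_mod_cast (hp i hi).1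
  · have := hc (p i) k
    rwa [(hp i hi).2.1] at this
  · have := ((hp i hi).2.2 k).2
    rw [hm k hk, zero_add] at this
    exact div_le_div_of_nonneg_right (by exact_mod_cast this) hN.le
  · rw [dist_pi_le_iff (by positivity)]
    intro k
    have h1 := (hp i hi).2.2 k
    have h2 := (hp j hj).2.2 k
    rw [Real.dist_eq, ← sub_div, abs_div, abs_of_pos hN]
    refine div_le_div_of_nonneg_right (abs_le.2 ?_) hN.le
    constructor
    · have : p j k ≤ p i k + Fintype.card I := by omega
      have : (p j k : ℝ) ≤ p i k + Fintype.card I := by exact_mod_cast this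
      linarith
    · have : p i k ≤ p j k + Fintype.card I := by omega
      have : (p i k : ℝ) ≤ p j k + Fintype.card I := by exact_mod_cast this
      linarith

/-- Every finite family of continuous functions, indexed by the vertices of a simplex, has a point
that is supported on the indices at which the family is maximal. -/
theorem exists_complementary_stdSimplex {I : Type*} [Fintype I] [Nonempty I]
    (g : I → (I → ℝ) → ℝ) (hg : ∀ i, Continuous (g i)) :
    ∃ x ∈ stdSimplex ℝ I, ∀ i, x i ≠ 0 → ∀ k, g k x ≤ g i x := by
  classical
  choose C p hCp using exists_almost_complementary g
  have hC := fun N => (hCp N).1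
  have hp := fun N => (hCp N).2
  -- Along an ultrafilter every index is eventually in `C N` or eventually outside it, so no
  -- subsequence making `C N` constant is needed.
  let U : Ultrafilter ℕ := hyperfilter ℕ
  have hU : (U : Filter ℕ) ≤ atTop := Nat.hyperfilter_le_atTop
  have hδ : Tendsto (fun N : ℕ => (Fintype.card I : ℝ) / ((N : ℝ) + 1)) U (𝓝 0) :=
    (tendsto_const_div_atTop_nhds_zero_nat (Fintype.card I : ℝ)).comp
      (tendsto_add_atTop_nat 1) |>.congr (fun N => by simp) |>.mono_left hU
  choose i₀ hi₀ using hC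
  obtain ⟨x, hx, hlim⟩ := (isCompact_stdSimplex ℝ I).ultrafilter_le_nhds
    (U.map fun N => p N (i₀ N)) 
      (tendsto_principal.2 (Eventually.of_forall fun N => (hp N _ (hi₀ N)).1))
  have hlim : Tendsto (fun N => p N (i₀ N)) U (𝓝 x) := hlim
  have hconv : ∀ i, (∀ᶠ N in (U : Filter ℕ), i ∈ C N) → Tendsto (fun N => p N i) U (𝓝 x) := by
    intro i hi
    refine (tendsto_iff_dist_tendsto_zero).2 ?_
    have h0 : Tendsto (fun N => dist (p N (i₀ N)) x + (Fintype.card I : ℝ) / ((N : ℝ) + 1)) U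
        (𝓝 0) := by
      simpa using ((tendsto_iff_dist_tendsto_zero).1 hlim).add hδ
    refine squeeze_zero' (Eventually.of_forall fun _ => dist_nonneg) ?_ h0
    filter_upwards [hi] with N hN
    have := (hp N i hN).2.2.2 _ (hi₀ N)
    linarith [dist_triangle (p N i) (p N (i₀ N)) x]
  refine ⟨x, hx, fun i hxi k => ?_⟩
  -- Coordinates outside `C N` are bounded by a multiple of the mesh and vanish in the limit.
  have hi : ∀ᶠ N in (U : Filter ℕ), i ∈ C N := by
    by_contra hcon
    rw [Ultrafilter.frequently_iff_eventually.symm.not, not_frequently] at hcon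
    refine hxi (le_antisymm ?_ (hx.1 i))
    refine le_of_tendsto_of_tendsto ((continuous_apply i).tendsto x |>.comp hlim) hδ ?_
    filter_upwards [hcon] with N hN
    exact (hp N _ (hi₀ N)).2.2.1 i hN
  refine le_of_tendsto_of_tendsto (((hg k).tendsto x).comp (hconv i hi))
    (((hg i).tendsto x).comp (hconv i hi)) ?_
  filter_upwards [hi] with N hN
  exact (hp N i hN).2.1 k

/-- A variational inequality on a compact convex set: some `p ∈ K` maximizes `h p` over `K`. -/
theorem exists_forall_le_of_isCompact_convex {E : Type*} [AddCommGroup E] [Module ℝ E]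
    [TopologicalSpace E] [ContinuousAdd E] [ContinuousSMul ℝ E] {K : Set E}
    (hK : IsCompact K) (hconv : Convex ℝ K) (hne : K.Nonempty) (h : E → E →ₗ[ℝ] ℝ)
    (hcont : ∀ v, Continuous fun p => h p v) (hdiag : Continuous fun p => h p p) :
    ∃ p ∈ K, ∀ v ∈ K, h p v ≤ h p p := by
  -- By compactness finitely many test points suffice, and their convex combinations are
  -- parameterized by a simplex.
  have key : (K ∩ ⋂ v : K, {p | h p v ≤ h p p}).Nonempty := by
    refine hK.inter_iInter_nonempty _ (fun v => isClosed_le (hcont v) hdiag) fun u => ?_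
    rcases u.eq_empty_or_nonempty with rfl | hu
    · simpa using hne
    have : Nonempty u := hu.to_subtype
    let φ : (u → ℝ) → E := fun x => ∑ i, x i • (i : K).1
    have hφ : Continuous φ := by fun_prop
    have hcomb : ∀ q x, h q (φ x) = ∑ i, x i * h q (i : K).1 := fun q x => by
      simp [φ, map_sum]
    obtain ⟨x, hx, hmax⟩ := exists_complementary_stdSimplex
      (fun (i : u) x => h (φ x) (i : K).1) (fun i => (hcont _).comp hφ)
    refine ⟨φ x, hconv.sum_mem (fun i _ => hx.1 i) hx.2 fun i _ => (i : K).2, ?_⟩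
    simp only [Set.mem_iInter, Set.mem_ofPred_eq]
    intro v hv
    -- At `p = φ x`, the value `h p p` is the average of the `h p i` with weights `x i`, and only
    -- maximal values carry weight.
    rw [hcomb, ← one_mul (h (φ x) v), ← hx.2, Finset.sum_mul]
    refine Finset.sum_le_sum fun i _ => ?_
    by_cases hxi : x i = 0
    · simp [hxi]
    · exact mul_le_mul_of_nonneg_left (hmax i hxi ⟨v, hv⟩) (hx.1 i)
  obtain ⟨p, hp, hpv⟩ := key
  exact ⟨p, hp, fun v hv => Set.mem_iInter.1 hpv ⟨v, hv⟩⟩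

end Simplex

/-! ### The feasible set of a leader is closed -/

section Closed

open Filter Topology

/-- Optimality of a feasible point of a linear program, in terms of the directions that are feasible
for some set of active constraints. -/
theorem linearProgram_optimal_iff {R κ : Type*} [Finite R] [Fintype κ] {W : R → κ → ℝ} {s : R → ℝ}
    {q y : κ → ℝ} (hy : ∀ r, W r ⬝ᵥ y ≤ s r) :
    (∀ y', (∀ r, W r ⬝ᵥ y' ≤ s r) → q ⬝ᵥ y ≤ q ⬝ᵥ y') ↔
      ∃ A : Set R, (∀ r ∈ A, W r ⬝ᵥ y = s r) ∧ ∀ d, (∀ r ∈ A, W r ⬝ᵥ d ≤ 0) → 0 ≤ q ⬝ᵥ d := by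
  constructor
  · intro h
    refine ⟨{r | W r ⬝ᵥ y = s r}, fun r hr => hr, fun d hd => ?_⟩
    have hev : ∀ᶠ ε : ℝ in 𝓝[>] 0, ∀ r, W r ⬝ᵥ (y + ε • d) ≤ s r := by
      rw [eventually_all]
      intro r
      rcases (hy r).eq_or_lt with hr | hr
      · filter_upwards [self_mem_nhdsWithin] with ε hε
        rw [dotProduct_add, dotProduct_smul, hr, smul_eq_mul]
        linarith [mul_nonpos_of_nonneg_of_nonpos (le_of_lt hε) (hd r hr)]
      · have hcont : Continuous fun ε : ℝ => W r ⬝ᵥ (y + ε • d) := by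
          unfold dotProduct
          fun_prop
        have : ∀ᶠ ε : ℝ in 𝓝 0, W r ⬝ᵥ (y + ε • d) < s r :=
          hcont.continuousAt.eventually_lt_const (by simpa using hr)
        exact (this.filter_mono nhdsWithin_le_nhds).mono fun ε => le_of_lt
    obtain ⟨ε, hε, hpos⟩ := (hev.and self_mem_nhdsWithin).exists
    have := h _ hε
    rw [dotProduct_add, dotProduct_smul, smul_eq_mul] at this
    exact nonneg_of_mul_nonneg_right (by linarith) hpos
  · rintro ⟨A, hA, h⟩ y' hy'
    have := h (y' - y) fun r hr => by
      rw [dotProduct_sub, hA r hr]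
      linarith [hy' r]
    rw [dotProduct_sub] at this
    linarith

/-- The rows `W` are independent of `z`, so each active set `A` has a fixed cone of directions and
gives a closed condition on `z`; there are finitely many `A`. -/
theorem isClosed_setOf_linearProgram_optimal {Z R κ : Type*} [TopologicalSpace Z] [Finite R]
    [Fintype κ] (W : R → κ → ℝ) {s : R → Z → ℝ} {q y : Z → κ → ℝ} (hs : ∀ r, Continuous (s r))
    (hq : Continuous q) (hy : Continuous y) :
    IsClosed {z | (∀ r, W r ⬝ᵥ y z ≤ s r z) ∧
      ∀ y', (∀ r, W r ⬝ᵥ y' ≤ s r z) → q z ⬝ᵥ y z ≤ q z ⬝ᵥ y'} := by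
  have heq : {z | (∀ r, W r ⬝ᵥ y z ≤ s r z) ∧
      ∀ y', (∀ r, W r ⬝ᵥ y' ≤ s r z) → q z ⬝ᵥ y z ≤ q z ⬝ᵥ y'} =
      ⋃ A : Set R, {z | (∀ r, W r ⬝ᵥ y z ≤ s r z) ∧ (∀ r ∈ A, W r ⬝ᵥ y z = s r z) ∧
        ∀ d, (∀ r ∈ A, W r ⬝ᵥ d ≤ 0) → 0 ≤ q z ⬝ᵥ d} := by
    ext z
    simp only [Set.mem_ofPred_eq, Set.mem_iUnion, exists_and_left]
    exact and_congr_right fun h => linearProgram_optimal_iff h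
  rw [heq]
  have hWy : ∀ r, Continuous fun z => W r ⬝ᵥ y z := fun r => continuous_const.dotProduct hy
  refine isClosed_iUnion_of_finite fun A => ?_
  simp only [Set.ofPred_and, Set.ofPred_forall]
  exact (isClosed_iInter fun r => isClosed_le (hWy r) (hs r)).inter <|
    (isClosed_iInter fun r => isClosed_iInter fun _ => isClosed_eq (hWy r) (hs r)).inter <|
    isClosed_iInter fun d => isClosed_iInter fun _ =>
      isClosed_le continuous_const (hq.dotProduct continuous_const)

theorem IsPolyhedron.isClosed {κ : Type*} [Fintype κ] {S : Set (κ → ℝ)} (h : IsPolyhedron S) :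
    IsClosed S := by
  obtain ⟨m, A, b, rfl⟩ := h
  exact isClosed_le (continuous_const.matrix_mulVec continuous_id) continuous_const

theorem isClosed_bilevelFeasible {κl κf : Type*} [Fintype κl] [Fintype κf]
    {F : Set (κl ⊕ κf → ℝ)} {P : SimpleParamProblem κl κf} (hF : IsPolyhedron F)
    (hP : P.IsLinearProgram) : IsClosed (bilevelFeasible F P) := by
  obtain ⟨⟨q, hq⟩, k, H, b, hH⟩ := hP
  let W : Fin k ⊕ Fin P.m → κf → ℝ := Sum.elim H P.B
  let s : Fin k ⊕ Fin P.m → (κl ⊕ κf → ℝ) → ℝ := fun r z =>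
    Sum.elim b (fun i => P.b i - (P.A *ᵥ (z ∘ Sum.inl)) i) r
  have hl : Continuous fun z : κl ⊕ κf → ℝ => z ∘ Sum.inl := by
    unfold Function.comp
    fun_prop
  have hr : Continuous fun z : κl ⊕ κf → ℝ => z ∘ Sum.inr := by
    unfold Function.comp
    fun_prop
  have hfeas : ∀ z y, y ∈ P.feasible (z ∘ Sum.inl) ↔ ∀ r, W r ⬝ᵥ y ≤ s r z := fun z y => by
    simp only [SimpleParamProblem.feasible, hH, Set.mem_ofPred_eq, Sum.forall, W, s, Sum.elim_inl,
      Sum.elim_inr, Pi.le_def, Pi.add_apply, mulVec, le_sub_iff_add_le, add_comm]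
    rfl
  have hcost : ∀ x y, P.cost x y = (q + P.C *ᵥ x) ⬝ᵥ y := fun x y => by
    rw [SimpleParamProblem.cost, hq, add_dotProduct]
  have := isClosed_setOf_linearProgram_optimal W (s := s) (q := fun z => q + P.C *ᵥ (z ∘ Sum.inl))
    (y := fun z => z ∘ Sum.inr) ?_ ?_ hr
  · convert hF.isClosed.inter this using 1
    ext z
    simp only [bilevelFeasible, SimpleParamProblem.sol, hfeas, hcost, Set.mem_ofPred_eq,
      Set.mem_inter_iff]
  · rintro (i | i)
    · exact continuous_const
    · exact continuous_const.sub
        ((continuous_apply i).comp (continuous_const.matrix_mulVec hl))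
  · exact continuous_const.add (continuous_const.matrix_mulVec hl)

end Closed

/-! ### Mixed strategies and their means -/

section Mixed

/-- By Carathéodory's theorem at most `finrank + 1` points are needed; `Fin (finrank + 2)` lists the
possible numbers of points, and each gives a continuous image of a compact set. -/
theorem IsCompact.isCompact_convexHull {E : Type*} [NormedAddCommGroup E] [NormedSpace ℝ E]
    [FiniteDimensional ℝ E] {s : Set E} (hs : IsCompact s) : IsCompact (convexHull ℝ s) := by
  have heq : convexHull ℝ s = ⋃ n : Fin (Module.finrank ℝ E + 2),
      (fun x : (Fin n → ℝ) × (Fin n → E) => ∑ i, x.1 i • x.2 i) ''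
        (stdSimplex ℝ (Fin n) ×ˢ Set.univ.pi fun _ => s) := by
    refine Set.Subset.antisymm (fun x hx => ?_) (Set.iUnion_subset fun n => ?_)
    · obtain ⟨ι, _, z, w, hz, hind, hw, hw1, rfl⟩ := eq_pos_convex_span_of_mem_convexHull hx
      have hcard : Fintype.card ι < Module.finrank ℝ E + 2 :=
        Nat.lt_succ_of_le (hind.card_le_finrank_succ.trans
          (Nat.succ_le_succ (Submodule.finrank_le _)))
      let e := (Fintype.equivFin ι).symm
      refine Set.mem_iUnion.2 ⟨⟨_, hcard⟩, (w ∘ e, z ∘ e), ⟨⟨fun i => (hw _).le, ?_⟩, ?_⟩, ?_⟩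
      · rw [← hw1]
        exact Equiv.sum_comp e w
      · exact fun i _ => hz (Set.mem_range_self _)
      · exact Equiv.sum_comp e fun i => w i • z i
    · rintro _ ⟨⟨w, z⟩, ⟨hw, hz⟩, rfl⟩
      exact (convex_convexHull ℝ s).sum_mem (fun i _ => hw.1 i) hw.2
        fun i _ => subset_convexHull ℝ s (hz i trivial)
  rw [heq]
  refine isCompact_iUnion fun n => IsCompact.image ?_ (by fun_prop)
  exact (isCompact_stdSimplex ℝ _).prod (isCompact_univ_pi fun _ => hs)

/-- Every point of a convex hull is the mean of a finitely supported distribution. -/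
theorem exists_measure_of_mem_convexHull {κ : Type*} [Fintype κ] {S : Set (κ → ℝ)} {p : κ → ℝ}
    (hp : p ∈ convexHull ℝ S) :
    ∃ ν : Measure (κ → ℝ), IsProbabilityMeasure ν ∧
      (∃ t : Finset (κ → ℝ), (t : Set (κ → ℝ)) ⊆ S ∧ ν (t : Set (κ → ℝ))ᶜ = 0) ∧
      ∀ a, Integrable (fun x => x a) ν ∧ ∫ x, x a ∂ν = p a := by
  rw [convexHull_eq_union_convexHull_finite_subsets] at hp
  simp only [Set.mem_iUnion] at hp
  obtain ⟨t, htS, hp⟩ := hp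
  obtain ⟨w, hw, hw1, rfl⟩ := Finset.mem_convexHull'.1 hp
  have hint : ∀ a, ∀ y ∈ t, Integrable (fun x : κ → ℝ => x a)
      (ENNReal.ofReal (w y) • Measure.dirac y) := fun a y _ =>
    (integrable_dirac enorm_lt_top).smul_measure ENNReal.ofReal_ne_top
  refine ⟨∑ y ∈ t, ENNReal.ofReal (w y) • Measure.dirac y, ⟨?_⟩, ⟨t, htS, ?_⟩, fun a => ⟨?_, ?_⟩⟩
  · simp only [Measure.finsetSum_apply, Measure.smul_apply, measure_univ, smul_eq_mul, mul_one]
    rw [← ENNReal.ofReal_sum_of_nonneg hw, hw1, ENNReal.ofReal_one]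
  · simp only [Measure.finsetSum_apply, Measure.smul_apply, smul_eq_mul]
    refine Finset.sum_eq_zero fun y hy => ?_
    rw [Measure.dirac_apply' _ t.measurableSet.compl]
    simp [hy]
  · exact integrable_finsetSum_measure.2 (hint a)
  · rw [integral_finsetSum_measure (hint a), Finset.sum_apply]
    refine Finset.sum_congr rfl fun y hy => ?_
    rw [integral_smul_measure, integral_dirac, ENNReal.toReal_ofReal (hw y hy)]
    rfl

variable {ι : Type*} [Fintype ι] {κ : ι → Type*} {ν : (i : ι) → Measure (κ i → ℝ)}
  [∀ i, IsProbabilityMeasure (ν i)]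

theorem integrable_pi_coordinate {i : ι} {a : κ i}
    (h : Integrable (fun x : κ i → ℝ => x a) (ν i)) :
    Integrable (fun x : (i : ι) → κ i → ℝ => x i a) (Measure.pi ν) :=
  integrable_comp_eval (X := fun i => κ i → ℝ) (f := fun x => x a) h

theorem integral_pi_coordinate {i : ι} {a : κ i}
    (h : Integrable (fun x : κ i → ℝ => x a) (ν i)) :
    ∫ x : (i : ι) → κ i → ℝ, x i a ∂(Measure.pi ν) = ∫ x, x a ∂(ν i) :=
  integral_comp_eval (X := fun i => κ i → ℝ) (f := fun x => x a) h.1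

theorem integrable_pi_coordinate_mul (hν : ∀ i a, Integrable (fun x : κ i → ℝ => x a) (ν i))
    {i j : ι} (hij : j ≠ i) (b : κ j) (a : κ i) :
    Integrable (fun x : (i : ι) → κ i → ℝ => x j b * x i a) (Measure.pi ν) ∧
      ∫ x, x j b * x i a ∂(Measure.pi ν) = (∫ x, x b ∂(ν j)) * ∫ x, x a ∂(ν i) := by
  have hind : ProbabilityTheory.IndepFun (fun x : (i : ι) → κ i → ℝ => x j b)
      (fun x => x i a) (Measure.pi ν) := by
    have := (ProbabilityTheory.iIndepFun_pi (μ := ν) (X := fun i => (id : (κ i → ℝ) → κ i → ℝ))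
      fun i => aemeasurable_id).indepFun hij
    exact this.comp (measurable_pi_apply b) (measurable_pi_apply a)
  have h1 := integrable_pi_coordinate (hν j b)
  have h2 := integrable_pi_coordinate (hν i a)
  refine ⟨hind.integrable_mul h1 h2, ?_⟩
  rw [hind.integral_fun_mul_eq_mul_integral h1.1 h2.1, integral_pi_coordinate (hν j b),
    integral_pi_coordinate (hν i a)]

variable [DecidableEq ι] [∀ i, Fintype (κ i)] {p : (i : ι) → κ i → ℝ}

/-- The sum omits `j = i`, so only products of independent coordinates occur and the means determine
the expectation. -/
theorem integral_linear_cost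
    (hν : ∀ i a, Integrable (fun x : κ i → ℝ => x a) (ν i) ∧ ∫ x, x a ∂(ν i) = p i a) (i : ι)
    (c : κ i → ℝ) (C : (j : ι) → Matrix (κ i) (κ j) ℝ) :
    ∫ x, (c + ∑ j ∈ Finset.univ.erase i, C j *ᵥ x j) ⬝ᵥ x i ∂(Measure.pi ν) =
      (c + ∑ j ∈ Finset.univ.erase i, C j *ᵥ p j) ⬝ᵥ p i := by
  have expand : ∀ x : (i : ι) → κ i → ℝ, (c + ∑ j ∈ Finset.univ.erase i, C j *ᵥ x j) ⬝ᵥ x i =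
      ∑ a, (c a * x i a + ∑ j ∈ Finset.univ.erase i, ∑ b, C j a b * (x j b * x i a)) := fun x => by
    simp only [dotProduct, Pi.add_apply, Finset.sum_apply, mulVec, add_mul, Finset.sum_mul,
      mul_assoc]
  have h1 : ∀ a, Integrable (fun x : (i : ι) → κ i → ℝ => c a * x i a) (Measure.pi ν) := fun a =>
    (integrable_pi_coordinate (hν i a).1).const_mul _
  have h2 : ∀ a, ∀ j ∈ Finset.univ.erase i, ∀ b ∈ Finset.univ,
      Integrable (fun x : (i : ι) → κ i → ℝ => C j a b * (x j b * x i a)) (Measure.pi ν) :=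
    fun a j hj b _ => (integrable_pi_coordinate_mul (fun i a => (hν i a).1)
      (Finset.ne_of_mem_erase hj) b a).1.const_mul _
  have h3 : ∀ a, ∀ j ∈ Finset.univ.erase i, Integrable (fun x : (i : ι) → κ i → ℝ =>
      ∑ b, C j a b * (x j b * x i a)) (Measure.pi ν) :=
    fun a j hj => integrable_finsetSum _ (h2 a j hj)
  have h4 : ∀ a ∈ Finset.univ, Integrable (fun x : (i : ι) → κ i → ℝ => c a * x i a +
      ∑ j ∈ Finset.univ.erase i, ∑ b, C j a b * (x j b * x i a)) (Measure.pi ν) :=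
    fun a _ => (h1 a).add (integrable_finsetSum _ (h3 a))
  simp only [expand]
  rw [integral_finsetSum _ h4]
  refine Finset.sum_congr rfl fun a _ => ?_
  rw [integral_add (h1 a) (integrable_finsetSum _ (h3 a)), integral_finsetSum _ (h3 a),
    integral_const_mul, integral_pi_coordinate (hν i a).1, (hν i a).2]
  congr 1
  refine Finset.sum_congr rfl fun j hj => ?_
  rw [integral_finsetSum _ (h2 a j hj)]
  refine Finset.sum_congr rfl fun b _ => ?_
  rw [integral_const_mul, (integrable_pi_coordinate_mul (fun i a => (hν i a).1)
      (Finset.ne_of_mem_erase hj) b a).2, (hν i a).2, (hν j b).2]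

theorem integral_linear_cost_update
    (hν : ∀ i a, Integrable (fun x : κ i → ℝ => x a) (ν i) ∧ ∫ x, x a ∂(ν i) = p i a) (i : ι)
    (c : κ i → ℝ) (C : (j : ι) → Matrix (κ i) (κ j) ℝ) (v : κ i → ℝ) :
    ∫ x, (c + ∑ j ∈ Finset.univ.erase i, C j *ᵥ Function.update x i v j) ⬝ᵥ
        Function.update x i v i ∂(Measure.pi ν) =
      (c + ∑ j ∈ Finset.univ.erase i, C j *ᵥ p j) ⬝ᵥ v := by
  have expand : ∀ x : (i : ι) → κ i → ℝ,
      (c + ∑ j ∈ Finset.univ.erase i, C j *ᵥ x j) ⬝ᵥ v =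
      ∑ a, (c a * v a + ∑ j ∈ Finset.univ.erase i, ∑ b, C j a b * v a * x j b) := fun x => by
    simp only [dotProduct, Pi.add_apply, Finset.sum_apply, mulVec, add_mul, Finset.sum_mul,
      mul_right_comm]
  have hupd : ∀ x : (i : ι) → κ i → ℝ,
      (c + ∑ j ∈ Finset.univ.erase i, C j *ᵥ Function.update x i v j) ⬝ᵥ Function.update x i v i =
      (c + ∑ j ∈ Finset.univ.erase i, C j *ᵥ x j) ⬝ᵥ v := fun x => by
    rw [Function.update_self]
    congr 2
    exact Finset.sum_congr rfl fun j hj => by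
      rw [Function.update_of_ne (Finset.ne_of_mem_erase hj)]
  have h2 : ∀ a, ∀ j ∈ Finset.univ.erase i, ∀ b ∈ Finset.univ,
      Integrable (fun x : (i : ι) → κ i → ℝ => C j a b * v a * x j b) (Measure.pi ν) :=
    fun a j _ b _ => (integrable_pi_coordinate (hν j b).1).const_mul _
  have h3 : ∀ a, ∀ j ∈ Finset.univ.erase i, Integrable (fun x : (i : ι) → κ i → ℝ =>
      ∑ b, C j a b * v a * x j b) (Measure.pi ν) :=
    fun a j hj => integrable_finsetSum _ (h2 a j hj)
  have h4 : ∀ a ∈ Finset.univ, Integrable (fun x : (i : ι) → κ i → ℝ => c a * v a +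
      ∑ j ∈ Finset.univ.erase i, ∑ b, C j a b * v a * x j b) (Measure.pi ν) :=
    fun a _ => (integrable_const _).add (integrable_finsetSum _ (h3 a))
  simp only [hupd, expand]
  rw [integral_finsetSum _ h4]
  refine Finset.sum_congr rfl fun a _ => ?_
  rw [integral_add (integrable_const _) (integrable_finsetSum _ (h3 a)),
    integral_finsetSum _ (h3 a)]
  congr 1
  · simp
  refine Finset.sum_congr rfl fun j hj => ?_
  rw [integral_finsetSum _ (h2 a j hj)]
  refine Finset.sum_congr rfl fun b _ => ?_
  rw [integral_const_mul, integral_pi_coordinate (hν j b).1, (hν j b).2]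

end Mixed

/-! ### ### Existence of equilibria -/

/-- A linear Nash game whose players have nonempty compact feasible sets has a mixed-strategy Nash
equilibrium. -/
theorem NashGame.IsLinear.exists_isMNE {ι : Type*} [Fintype ι] [DecidableEq ι] {κ : ι → Type*}
    [∀ i, Fintype (κ i)] {G : NashGame κ} (hG : G.IsLinear)
    (hne : ∀ i, (G.feasible i).Nonempty) (hcomp : ∀ i, IsCompact (G.feasible i)) :
    ∃ ν : (i : ι) → Measure (κ i → ℝ), G.IsMNE ν := by
  choose c C hcost using hG
  let u : (i : ι) → ((j : ι) → κ j → ℝ) → κ i → ℝ := fun i p =>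
    c i + ∑ j ∈ Finset.univ.erase i, C i j *ᵥ p j
  have hu : ∀ i, Continuous (u i) := fun i => continuous_const.add <|
    continuous_finsetSum _ fun j _ => continuous_const.matrix_mulVec (continuous_apply j)
  -- `h p v` is minus the total cost of the replies `v i` to `p`. If `p` itself maximizes `h p` on
  -- the product of the hulls, each `p i` is a best reply.
  let h : ((j : ι) → κ j → ℝ) → ((j : ι) → κ j → ℝ) →ₗ[ℝ] ℝ := fun p =>
    { toFun := fun v => -∑ i, u i p ⬝ᵥ v i
      map_add' := fun v w => by
        simp only [Pi.add_apply, dotProduct_add, Finset.sum_add_distrib, neg_add]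
      map_smul' := fun r v => by
        simp only [Pi.smul_apply, dotProduct_smul, ← Finset.smul_sum, smul_neg, RingHom.id_apply] }
  obtain ⟨p, hp, hmax⟩ := exists_forall_le_of_isCompact_convex
    (K := Set.univ.pi fun i => convexHull ℝ (G.feasible i))
    (isCompact_univ_pi fun i => (hcomp i).isCompact_convexHull)
    (convex_pi fun i _ => convex_convexHull ℝ _)
    (Set.univ_pi_nonempty_iff.2 fun i => (hne i).convexHull) h
    (fun v => (continuous_finsetSum _ fun i _ => (hu i).dotProduct continuous_const).neg)
    (continuous_finsetSum _ fun i _ => (hu i).dotProduct (continuous_apply i)).neg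
  have hbest : ∀ i, ∀ v ∈ G.feasible i, u i p ⬝ᵥ p i ≤ u i p ⬝ᵥ v := fun i v hv => by
    -- Only the block of `i` deviates, so the other terms of the two sums cancel.
    have h1 := hmax (Function.update p i v) fun j _ => by
      by_cases hj : j = i
      · subst hj
        rw [Function.update_self]
        exact subset_convexHull ℝ _ hv
      · rw [Function.update_of_ne hj]
        exact hp j trivial
    have h2 : ∑ j, u j p ⬝ᵥ p j ≤ ∑ j, u j p ⬝ᵥ Function.update p i v j := neg_le_neg_iff.1 h1
    rw [← Finset.add_sum_erase _ _ (Finset.mem_univ i),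
      ← Finset.add_sum_erase _ (fun j => u j p ⬝ᵥ Function.update p i v j) (Finset.mem_univ i),
      Function.update_self, Finset.sum_congr rfl fun j hj => by
        rw [← Function.update_of_ne (Finset.ne_of_mem_erase hj) v p]] at h2
    exact le_of_add_le_add_right h2
  choose ν hprob hsupp hν using fun i => exists_measure_of_mem_convexHull (hp i trivial)
  refine ⟨ν, hprob, hsupp, fun i v hv => ?_⟩
  simp only [hcost]
  rw [integral_linear_cost hν, integral_linear_cost_update hν]
  exact hbest i v hv

theorem mainTheorem3 (nl nf : Fin 2 → ℕ)
    (G : NashGame (fun i : Fin 2 => Fin (nl i) ⊕ Fin (nf i)))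
    (hG : IsTrivialNASP G)
    (hnonempty : ∀ i, (G.feasible i).Nonempty)
    (hbounded : ∀ i, Bornology.IsBounded (G.feasible i)) :
    ∃ ν : (i : Fin 2) → Measure (Fin (nl i) ⊕ Fin (nf i) → ℝ), G.IsMNE ν := by
  refine hG.isLinear.exists_isMNE hnonempty fun i => ?_
  obtain ⟨F, P, hF, hP, h⟩ := hG.feasible_eq i
  exact Metric.isCompact_of_isClosed_isBounded (h ▸ isClosed_bilevelFeasible hF hP) (hbounded i)
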